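/- Definitions. All graphs are finite. Let $C_q$ be the cycle on $q$ vertices (for $q\ge 3$; as simple graphs, $C_0$ is the empty graph, $C_1$ is a single vertex without edges, and $C_2$ is a single edge on two vertices). For $k\in\mathbb N=\{0,1,2,\ldots\}$ let $C_q^k$ be the Cartesian product of $k$ copies of $C_q$: its vertices are the $k$-tuples of vertices of $C_q$, and two $k$-tuples are adjacent when their entries in one coordinate are adjacent in $C_q$ and their entries in every other coordinate are equal (so $C_q^0$ is a single vertex). For a graph $G$, the chromatic polynomial $\chi_G(n)$ is the polynomial whose value at each $n\in\mathbb N$ is the number of proper vertex colorings of $G$ with $n$ colors. A numerical polynomial is a $g\in\mathbb Q[x]$ with $g(z)\in\mathbb Z$ for all $z\in\mathbb Z$. Let $g$ be a numerical polynomial with $g(q)\ge 0$ for all sufficiently large $q$, let $S=\{q\in\mathbb N : g(q)\ge 0\}$, and let $e:S\to\mathbb N\cup\{-1,\infty\}$. A two-level polynomial of degree $g$ and depth $e$ is a sequence of polynomials $\{f_q\}_{q\in S}$ in $\mathbb Q[n]$, with $f_q$ of degree exactly $g(q)$, such that, writing \[ f_q(n)=\sum_{r=0}^{\infty} c_r(q)\,n^{g(q)-r},\qquad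 c_r(q)=0 \text{ for } r>g(q), \] there exist polynomials $\phi_r\in\mathbb Q[x]$ $(r\ge 0)$ with $c_r(q)=\phi_r(q)$ for every $q\in S$ and every integer $r$ with $0\le r\le e(q)$. (For $q\in\mathbb N\setminus S$ one sets $f_q=0$ and $e(q)=-1$.) Theorem. For every fixed $k\in\mathbb N$, the sequence of chromatic polynomials $\{\chi_{C_q^k}(n)\}_{q\in\mathbb N}$ is a two-level polynomial of degree $g(q)=q^k$ and depth $e(q)=\max(q-2,-1)$; that is, of depth $q-2$ for every $q\ge 1$, and of depth $-1$ for $q=0$. (Here $g$ is the polynomial $x^k$, so $q^0=1$ for every $q$.) -/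

import Mathlib

open Polynomial

/-- The Cartesian power `G^k`: vertices are the `k`-tuples of vertices of `G`, and two tuples are
adjacent when they are adjacent in `G` in one coordinate and agree in all the others. -/
def SimpleGraph.cartesianPower {V : Type*} (G : SimpleGraph V) (k : ℕ) :
    SimpleGraph (Fin k → V) where
  Adj x y := ∃ i, G.Adj (x i) (y i) ∧ ∀ j, j ≠ i → x j = y j
  symm := ⟨fun _ _ ⟨i, h, h'⟩ => ⟨i, h.symm, fun j hj => (h' j hj).symm⟩⟩
  loopless := ⟨fun _ ⟨_, h, _⟩ => h.ne rfl⟩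

/-- The colorings with a given partition into color classes: there are none when some class
contains an edge, and otherwise they are the injections from the classes to the colors. -/
theorem SimpleGraph.card_coloring_ker {V : Type*} [Finite V] (G : SimpleGraph V) (s : Setoid V) :
    ∃ p : ℚ[X], ∀ n : ℕ,
      p.eval (n : ℚ) = Nat.card {c : G.Coloring (Fin n) // Setoid.ker c = s} := by
  classical
  by_cases hs : ∀ u v, G.Adj u v → ¬ s u v
  · refine ⟨descPochhammer ℚ (Nat.card (Quotient s)), fun n => ?_⟩
    have e : {c : G.Coloring (Fin n) // Setoid.ker c = s} ≃ (Quotient s ↪ Fin n) :=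
      { toFun := fun c => ⟨Quotient.lift (c.1 : V → Fin n)
            (fun a b h => by
              have h' : (Setoid.ker c.1) a b := by rw [c.2]; exact h
              exact h'), by
          intro x y
          induction x using Quotient.inductionOn with | _ a =>
          induction y using Quotient.inductionOn with | _ b =>
          intro h
          have h' : (Setoid.ker c.1) a b := h
          rw [c.2] at h'
          exact Quotient.sound h'⟩
        invFun := fun f => ⟨SimpleGraph.Coloring.mk (fun v => f (Quotient.mk s v))
            (fun {u v} huv h => hs u v huv (Quotient.exact (f.injective h))), by
          ext a b
          constructor
          · intro h
            exact Quotient.exact (f.injective h)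
          · intro h
            exact congrArg f (Quotient.sound h)⟩
        left_inv := fun c => by ext; rfl
        right_inv := fun f => by
          ext x
          induction x using Quotient.inductionOn with | _ a => rfl }
    have := Fintype.ofFinite (Quotient s)
    rw [Nat.card_congr e, descPochhammer_eval_eq_descFactorial,
      Nat.card_eq_fintype_card (α := Quotient s), Nat.card_eq_fintype_card,
      Fintype.card_embedding_eq, Fintype.card_fin]
  · refine ⟨0, fun n => ?_⟩
    push Not at hs
    obtain ⟨u, v, huv, h⟩ := hs
    have : IsEmpty {c : G.Coloring (Fin n) // Setoid.ker c = s} := ⟨fun c => by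
      have h' : (Setoid.ker c.1) u v := by rw [c.2]; exact h
      exact c.1.valid huv h'⟩
    simp

/-- For a finite graph `G` there is exactly one polynomial whose value at every natural number `n`
is the number of proper vertex colorings of `G` with `n` colors. -/
theorem SimpleGraph.existsUnique_chromaticPolynomial {V : Type*} [Finite V] (G : SimpleGraph V) :
    ∃! p : ℚ[X], ∀ n : ℕ, p.eval (n : ℚ) = Nat.card (G.Coloring (Fin n)) := by
  classical
  choose p hp using G.card_coloring_ker
  have : Finite (Setoid V) := Finite.of_injective (fun s : Setoid V => (s : V → V → Prop))
    (fun s t h => Setoid.ext fun a b => iff_of_eq (congrFun (congrFun h a) b))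
  have := Fintype.ofFinite (Setoid V)
  refine ⟨∑ s, p s, fun n => ?_, fun p' hp' => ?_⟩
  · have : Finite (G.Coloring (Fin n)) :=
      Finite.of_injective (fun c : G.Coloring (Fin n) => (c : V → Fin n)) DFunLike.coe_injective
    rw [Polynomial.eval_finsetSum,
      ← Nat.card_congr (Equiv.sigmaFiberEquiv fun c : G.Coloring (Fin n) => Setoid.ker c),
      Nat.card_sigma]
    push_cast
    exact Finset.sum_congr rfl fun s _ => hp s n
  · refine Polynomial.eq_of_infinite_eval_eq _ _
      ((Set.infinite_range_of_injective (Nat.cast_injective (R := ℚ))).mono ?_)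
    rintro _ ⟨n, rfl⟩
    simp only [Set.mem_ofPred_eq]
    rw [hp' n, Polynomial.eval_finsetSum,
      ← Nat.card_congr (Equiv.sigmaFiberEquiv fun c : G.Coloring (Fin n) => Setoid.ker c)]
    have : Finite (G.Coloring (Fin n)) :=
      Finite.of_injective (fun c : G.Coloring (Fin n) => (c : V → Fin n)) DFunLike.coe_injective
    rw [Nat.card_sigma]
    push_cast
    exact Finset.sum_congr rfl fun s _ => (hp s n).symm

/-- The chromatic polynomial of a finite graph: the polynomial whose value at every natural
number `n` is the number of proper vertex colorings with `n` colors. -/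
noncomputable def SimpleGraph.chromaticPolynomial {V : Type*} [Finite V] (G : SimpleGraph V) :
    ℚ[X] :=
  G.existsUnique_chromaticPolynomial.choose

theorem SimpleGraph.chromaticPolynomial_eval {V : Type*} [Finite V] (G : SimpleGraph V) (n : ℕ) :
    G.chromaticPolynomial.eval (n : ℚ) = Nat.card (G.Coloring (Fin n)) :=
  G.existsUnique_chromaticPolynomial.choose_spec.1 n

/-- The codegree `r` coefficient of `p`: the coefficient in degree `deg p - r`, and `0` when
`r > deg p`. -/
noncomputable def codegreeCoeff (p : ℚ[X]) (r : ℕ) : ℚ :=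
  if r ≤ p.natDegree then p.coeff (p.natDegree - r) else 0

/-- A numerical polynomial: rational coefficients, integer values on all integers. -/
def IsNumericalPolynomial (g : ℚ[X]) : Prop :=
  ∀ z : ℤ, ∃ m : ℤ, g.eval (z : ℚ) = m

/-- `f` is a two-level polynomial of degree `g` and depth `e`. A depth is an element of
`ℕ ∪ {-1, ∞}`, written as an element of `WithTop ℤ` that is at least `-1`. The set `S` of the
definition is `{q : ℕ | 0 ≤ g(q)}`; outside it, `f q = 0` and `e q = -1` by convention. -/
structure IsTwoLevelPolynomial (g : ℚ[X]) (e : ℕ → WithTop ℤ) (f : ℕ → ℚ[X]) : Prop where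
  numerical : IsNumericalPolynomial g
  eventually_nonneg : ∀ᶠ q : ℕ in Filter.atTop, 0 ≤ g.eval (q : ℚ)
  neg_one_le_depth : ∀ q : ℕ, ((-1 : ℤ) : WithTop ℤ) ≤ e q
  zero_of_neg : ∀ q : ℕ, g.eval (q : ℚ) < 0 → f q = 0 ∧ e q = ((-1 : ℤ) : WithTop ℤ)
  degree_eq : ∀ q : ℕ, 0 ≤ g.eval (q : ℚ) →
    f q ≠ 0 ∧ ((f q).natDegree : ℚ) = g.eval (q : ℚ)
  exists_coeff : ∃ φ : ℕ → ℚ[X], ∀ q : ℕ, 0 ≤ g.eval (q : ℚ) →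
    ∀ r : ℕ, ((r : ℤ) : WithTop ℤ) ≤ e q → codegreeCoeff (f q) r = (φ r).eval (q : ℚ)

/-! By Whitney's expansion, the codegree `r` coefficient of the chromatic polynomial is the
coefficient of `X^r` in `Z = ∑ A, (-1)^|A| X^(ρ A)`, where `A` runs over edge sets and `ρ` is the
graphic rank. The coefficients of `Z` are not proportional to the volume `q^k`, but those of its
logarithmic derivative `L = X Z' / Z` are, in low order.

To see this, restrict to edge subsets `B`, giving `Z_B` and `L_B`, and let `ℓ` be the Möbius
transform of `B ↦ L_B`, so that `L_B` is the sum of `ℓ A` over `A ⊆ B`. Since `Z` is multiplicative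
over splittings without common vertices, `L` is additive and `ℓ` vanishes on disconnected sets
(`moebius_rankLogSeries_eq_zero_of_not_edgeConnected`). Moreover `X^(ρ B)` divides `ℓ B`
(`X_pow_dvd_moebius_rankLogSeries`). Hence only nonempty connected `B` of rank at most `j`
contribute to the coefficient of `X^j` in `L`.

Such a `B` has at most `j + 1` vertices. If `j ≤ q - 2`, it misses a coordinate in every direction
of the torus, so it lifts to the lattice `ℕ^k`. Once all least coordinates of the lift are
normalized to `0`, the lift and its origin in the torus are unique. The coefficient is therefore
`q^k` times a number independent of `q` (`coeff_rankLogSeries_torus`). The recursion `r z_r = ∑ z_i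
ℓ_(r-i)` read off from `Z L = X Z'`, with `z_i` and `ℓ_i` the coefficients of `Z` and `L`, then
makes each `z_r` a polynomial in `q` for `r ≤ q - 2`. -/

/-! ### Möbius transforms of set functions. -/

/-- The Möbius transform of a set function `F`: the function `f` with
`∑ A ⊆ B, f A = F B` for all `B`. -/
noncomputable def Finset.moebius {E M : Type*} [DecidableEq E] [AddCommGroup M]
    (F : Finset E → M) : Finset E → M :=
  Finset.strongInduction fun B ih =>
    F B - ∑ A ∈ B.ssubsets.attach, ih A.1 (Finset.mem_ssubsets.1 A.2)

section Moebius

variable {E M : Type*} [DecidableEq E] [AddCommGroup M]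

theorem Finset.moebius_eq (F : Finset E → M) (B : Finset E) :
    Finset.moebius F B = F B - ∑ A ∈ B.ssubsets, Finset.moebius F A := by
  conv_lhs => rw [Finset.moebius, Finset.strongInduction_eq]
  rw [← Finset.sum_attach B.ssubsets]
  rfl

theorem Finset.sum_powerset_eq_add_ssubsets (f : Finset E → M) (B : Finset E) :
    ∑ A ∈ B.powerset, f A = f B + ∑ A ∈ B.ssubsets, f A := by
  rw [Finset.ssubsets, Finset.add_sum_erase _ _ (Finset.mem_powerset_self B)]

theorem Finset.sum_moebius (F : Finset E → M) (B : Finset E) :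
    ∑ A ∈ B.powerset, Finset.moebius F A = F B := by
  rw [Finset.sum_powerset_eq_add_ssubsets, Finset.moebius_eq]
  abel

theorem Finset.eq_of_sum_powerset_eq {f g : Finset E → M}
    (h : ∀ B : Finset E, ∑ A ∈ B.powerset, f A = ∑ A ∈ B.powerset, g A) (B : Finset E) :
    f B = g B := by
  induction B using Finset.strongInduction with
  | H B ih =>
    have hB := h B
    rw [Finset.sum_powerset_eq_add_ssubsets, Finset.sum_powerset_eq_add_ssubsets,
      Finset.sum_congr rfl fun A hA => ih A (Finset.mem_ssubsets.1 hA)] at hB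
    exact add_right_cancel hB

/-- The Möbius transform of a set function vanishes on `B` when the function is additive on the
subsets of `B` with respect to a splitting of `B` into two nonempty parts. -/
theorem Finset.moebius_eq_zero_of_additive (F : Finset E → M) (p : E → Prop) [DecidablePred p]
    (B : Finset E)
    (hF : ∀ A ⊆ B, F A = F (A.filter p) + F (A.filter fun e => ¬ p e))
    (h1 : (B.filter p).Nonempty) (h2 : (B.filter fun e => ¬ p e).Nonempty) :
    Finset.moebius F B = 0 := by
  have h0 : F ∅ = 0 := by simpa using hF ∅ (Finset.empty_subset B)
  induction B using Finset.strongInduction with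
  | H B ih =>
    set B1 := B.filter p with hB1
    set B2 := B.filter fun e => ¬ p e with hB2
    -- By induction, proper subsets meeting both parts contribute nothing. The rest lie in one part,
    -- and only `∅` lies in both.
    have key : ∑ A ∈ B.ssubsets, Finset.moebius F A
        = ∑ A ∈ B1.powerset ∪ B2.powerset, Finset.moebius F A := by
      symm
      apply Finset.sum_subset
      · intro A hA
        rw [Finset.mem_ssubsets]
        obtain ⟨a, ha⟩ := h1
        obtain ⟨b, hb⟩ := h2
        simp only [Finset.mem_union, Finset.mem_powerset, hB1, hB2] at hA ha hb
        rw [Finset.mem_filter] at ha hb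
        rcases hA with hA | hA
        · refine ⟨hA.trans (Finset.filter_subset _ _), fun h => hb.2 ?_⟩
          exact (Finset.mem_filter.1 (hA (h hb.1))).2
        · refine ⟨hA.trans (Finset.filter_subset _ _), fun h => ?_⟩
          exact (Finset.mem_filter.1 (hA (h ha.1))).2 ha.2
      · intro A hA hA'
        rw [Finset.mem_ssubsets] at hA
        simp only [Finset.mem_union, Finset.mem_powerset, not_or, Finset.not_subset] at hA'
        obtain ⟨⟨a, ha, ha'⟩, b, hb, hb'⟩ := hA'
        refine ih A hA (fun C hC => hF C (hC.trans hA.1)) ⟨b, ?_⟩ ⟨a, ?_⟩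
        · by_contra hcon
          exact hb' (Finset.mem_filter.2 ⟨hA.1 hb, fun h => hcon (Finset.mem_filter.2 ⟨hb, h⟩)⟩)
        · exact Finset.mem_filter.2 ⟨ha, fun h => ha' (Finset.mem_filter.2 ⟨hA.1 ha, h⟩)⟩
    have hinter : B1.powerset ∩ B2.powerset = {∅} := by
      have hd : Disjoint B1 B2 := Finset.disjoint_filter_filter_not B B p
      ext A
      rw [Finset.mem_inter, Finset.mem_powerset, Finset.mem_powerset, ← Finset.subset_inter_iff,
        Finset.disjoint_iff_inter_eq_empty.1 hd, Finset.subset_empty, Finset.mem_singleton]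
    have hsum := Finset.sum_union_inter (s₁ := B1.powerset) (s₂ := B2.powerset)
      (f := Finset.moebius F)
    rw [hinter, Finset.sum_singleton, Finset.sum_moebius, Finset.sum_moebius] at hsum
    have he : Finset.moebius F ∅ = 0 := by
      have := Finset.sum_moebius F ∅
      simpa [h0] using this
    rw [he, add_zero] at hsum
    rw [Finset.moebius_eq, key, hsum, hF B subset_rfl, sub_self]

/-- The transform at `B` sees only the subsets of `B`, so injectivity on `B` suffices. This matters
because the wrapping map onto the torus is not globally injective. -/
theorem Finset.moebius_image {E' : Type*} [DecidableEq E'] (F : Finset E → M)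
    (F' : Finset E' → M) (f : E → E') (B : Finset E) (hf : Set.InjOn f B)
    (hF : ∀ A ⊆ B, F' (A.image f) = F A) :
    Finset.moebius F' (B.image f) = Finset.moebius F B := by
  induction B using Finset.strongInduction with
  | H B ih =>
    rw [Finset.moebius_eq, Finset.moebius_eq, hF B subset_rfl]
    congr 1
    symm
    refine Finset.sum_bij (fun A _ => A.image f) ?_ ?_ ?_ ?_
    · intro A hA
      rw [Finset.mem_ssubsets] at hA ⊢
      refine ⟨Finset.image_subset_image hA.1, fun h => hA.2 fun b hb => ?_⟩
      obtain ⟨a, ha, hab⟩ := Finset.mem_image.1 (h (Finset.mem_image_of_mem f hb))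
      rwa [← hf (hA.1 ha) hb hab]
    · intro A hA A' hA' h
      rw [Finset.mem_ssubsets] at hA hA'
      exact Finset.image_injOn_powerset_of_injOn hf (Finset.mem_powerset.2 hA.1)
        (Finset.mem_powerset.2 hA'.1) h
    · intro C hC
      rw [Finset.mem_ssubsets] at hC
      obtain ⟨A, hA, rfl⟩ := Finset.subset_image_iff.1 hC.1
      refine ⟨A, ?_, rfl⟩
      rw [Finset.mem_ssubsets]
      exact ⟨hA, fun h => hC.2 (Finset.image_subset_image h)⟩
    · intro A hA
      rw [Finset.mem_ssubsets] at hA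
      exact (ih A hA (hf.mono hA.1) fun C hC => hF C (hC.trans hA.1)).symm

/-- The product of set functions corresponds to the union convolution of their Möbius
transforms. -/
theorem Finset.sum_powerset_union_convolution {R : Type*} [CommRing R] (f g : Finset E → R)
    (B : Finset E) :
    ∑ D ∈ B.powerset, ∑ P ∈ D.powerset ×ˢ D.powerset with P.1 ∪ P.2 = D, f P.1 * g P.2
      = (∑ A ∈ B.powerset, f A) * ∑ A ∈ B.powerset, g A := by
  rw [Finset.sum_mul_sum, ← Finset.sum_product',
    ← Finset.sum_fiberwise_of_maps_to (s := B.powerset ×ˢ B.powerset) (t := B.powerset)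
      (g := fun P => P.1 ∪ P.2)]
  · refine Finset.sum_congr rfl fun D hD => Finset.sum_congr ?_ fun _ _ => rfl
    rw [Finset.mem_powerset] at hD
    ext P
    simp only [Finset.mem_filter, Finset.mem_product, Finset.mem_powerset]
    constructor
    · rintro ⟨⟨h1, h2⟩, h⟩
      exact ⟨⟨h1.trans hD, h2.trans hD⟩, h⟩
    · rintro ⟨-, rfl⟩
      exact ⟨⟨Finset.subset_union_left, Finset.subset_union_right⟩, rfl⟩
  · intro P hP
    simp only [Finset.mem_product, Finset.mem_powerset] at hP ⊢
    exact Finset.union_subset hP.1 hP.2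

end Moebius

/-! ### The rank generating series and its logarithmic derivative. -/

section RankSeries

variable {E : Type*}

/-- The rank generating series `∑ A ⊆ B, (-1)^|A| X^(ρ A)` of a set function `ρ`. -/
noncomputable def rankSeries (ρ : Finset E → ℕ) (B : Finset E) : PowerSeries ℚ :=
  ∑ A ∈ B.powerset, (-1) ^ A.card * PowerSeries.X ^ ρ A

/-- The Euler derivation `X d/dX` applied to the logarithm of `rankSeries ρ B`. -/
noncomputable def rankLogSeries (ρ : Finset E → ℕ) (B : Finset E) : PowerSeries ℚ :=
  PowerSeries.X * PowerSeries.derivative ℚ (rankSeries ρ B) * (rankSeries ρ B)⁻¹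

theorem constantCoeff_rankSeries {ρ : Finset E → ℕ} (h : ∀ A, ρ A = 0 ↔ A = ∅) (B : Finset E) :
    PowerSeries.constantCoeff (rankSeries ρ B) = 1 := by
  rw [rankSeries, map_sum, Finset.sum_eq_single ∅]
  · simp [(h ∅).2 rfl]
  · intro A _ hA
    have : ρ A ≠ 0 := fun h' => hA ((h A).1 h')
    simp [this]
  · intro h
    exact absurd (Finset.empty_mem_powerset B) h

theorem rankSeries_mul_rankLogSeries {ρ : Finset E → ℕ} (h : ∀ A, ρ A = 0 ↔ A = ∅)
    (B : Finset E) :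
    rankSeries ρ B * rankLogSeries ρ B
      = PowerSeries.X * PowerSeries.derivative ℚ (rankSeries ρ B) := by
  have h1 : rankSeries ρ B * (rankSeries ρ B)⁻¹ = 1 :=
    PowerSeries.mul_inv_cancel _ (by rw [constantCoeff_rankSeries h]; exact one_ne_zero)
  rw [rankLogSeries, mul_left_comm, h1, mul_one]

theorem rankLogSeries_empty {ρ : Finset E → ℕ} (h : ρ ∅ = 0) : rankLogSeries ρ ∅ = 0 := by
  have h1 : rankSeries ρ ∅ = 1 := by simp [rankSeries, h]
  rw [rankLogSeries, h1, Derivation.map_one_eq_zero, mul_zero, zero_mul]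

/-- The Euler derivation multiplies `X^(ρ A)` by `ρ A`; this exhibits the Möbius transform of `B ↦ X
Z_B'`. -/
theorem X_mul_derivative_rankSeries (ρ : Finset E → ℕ) (B : Finset E) :
    PowerSeries.X * PowerSeries.derivative ℚ (rankSeries ρ B)
      = ∑ A ∈ B.powerset, (ρ A : PowerSeries ℚ) * ((-1) ^ A.card * PowerSeries.X ^ ρ A) := by
  rw [rankSeries, map_sum, Finset.mul_sum]
  refine Finset.sum_congr rfl fun A _ => ?_
  ext m
  have : ((-1 : PowerSeries ℚ)) ^ A.card = PowerSeries.C ((-1) ^ A.card) := by simp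
  rw [this, ← map_natCast (PowerSeries.C (R := ℚ)) (ρ A), PowerSeries.coeff_C_mul,
    PowerSeries.coeff_C_mul]
  cases m with
  | zero =>
    by_cases h : ρ A = 0
    · simp [h]
    · simp [PowerSeries.coeff_X_pow, Ne.symm h]
  | succ m =>
    rw [PowerSeries.coeff_succ_X_mul, PowerSeries.coeff_derivative, PowerSeries.coeff_C_mul,
      PowerSeries.coeff_X_pow]
    split_ifs with h
    · rw [← h]; push_cast; ring
    · simp

theorem rankSeries_image {E' : Type*} [DecidableEq E'] {ρ : Finset E → ℕ} {ρ' : Finset E' → ℕ}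
    (f : E → E') (B : Finset E) (hf : Set.InjOn f B)
    (hρ : ∀ A ⊆ B, ρ' (A.image f) = ρ A) :
    rankSeries ρ' (B.image f) = rankSeries ρ B := by
  rw [rankSeries, rankSeries, Finset.powerset_image, Finset.sum_image]
  · refine Finset.sum_congr rfl fun A hA => ?_
    rw [Finset.mem_powerset] at hA
    rw [hρ A hA, Finset.card_image_of_injOn (hf.mono hA)]
  · exact Finset.image_injOn_powerset_of_injOn hf

variable [DecidableEq E]

theorem X_pow_dvd_moebius_rankLogSeries {ρ : Finset E → ℕ} (h0 : ∀ A, ρ A = 0 ↔ A = ∅)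
    (hsub : ∀ A B, ρ (A ∪ B) ≤ ρ A + ρ B) (B : Finset E) :
    PowerSeries.X ^ ρ B ∣ Finset.moebius (rankLogSeries ρ) B := by
  -- Möbius-inverted form of `Z_B L_B = X Z_B'`: the product becomes a union convolution.
  have hconv : ∀ D : Finset E,
      ∑ P ∈ D.powerset ×ˢ D.powerset with P.1 ∪ P.2 = D,
        ((-1) ^ P.1.card * PowerSeries.X ^ ρ P.1) * Finset.moebius (rankLogSeries ρ) P.2
      = (ρ D : PowerSeries ℚ) * ((-1) ^ D.card * PowerSeries.X ^ ρ D) := by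
    refine Finset.eq_of_sum_powerset_eq fun B => ?_
    rw [Finset.sum_powerset_union_convolution
      (fun A => ((-1) ^ A.card * PowerSeries.X ^ ρ A : PowerSeries ℚ)), Finset.sum_moebius,
      ← X_mul_derivative_rankSeries, ← rankSeries_mul_rankLogSeries h0, rankSeries]
  induction B using Finset.strongInduction with
  | H B ih =>
    have hB := hconv B
    -- The pairs with `P.2 = B` add up to `Z_B` times the transform at `B`, and `Z_B` is a unit. For
    -- the others, induction and subadditivity of `ρ` give the divisibility.
    rw [← Finset.sum_filter_add_sum_filter_not _ (fun P => P.2 = B)] at hB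
    have h1 : ∑ P ∈ (B.powerset ×ˢ B.powerset).filter (fun P => P.1 ∪ P.2 = B) with P.2 = B,
        ((-1) ^ P.1.card * PowerSeries.X ^ ρ P.1) * Finset.moebius (rankLogSeries ρ) P.2
        = rankSeries ρ B * Finset.moebius (rankLogSeries ρ) B := by
      rw [rankSeries, Finset.sum_mul]
      symm
      refine Finset.sum_bij (fun A _ => (A, B)) ?_ ?_ ?_ ?_
      · intro A hA
        simpa using hA
      · intro A _ A' _ h
        exact congrArg Prod.fst h
      · rintro ⟨A, C⟩ h
        simp only [Finset.mem_filter, Finset.mem_product] at h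
        exact ⟨A, h.1.1.1, by rw [h.2]⟩
      · intro A _
        rfl
    have h2 : PowerSeries.X ^ ρ B ∣
        ∑ P ∈ (B.powerset ×ˢ B.powerset).filter (fun P => P.1 ∪ P.2 = B) with ¬ P.2 = B,
        ((-1) ^ P.1.card * PowerSeries.X ^ ρ P.1) * Finset.moebius (rankLogSeries ρ) P.2 := by
      refine Finset.dvd_sum fun P hP => ?_
      simp only [Finset.mem_filter, Finset.mem_product, Finset.mem_powerset] at hP
      have hss : P.2 ⊂ B := hP.1.1.2.ssubset_of_ne hP.2
      have hle := hsub P.1 P.2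
      rw [hP.1.2] at hle
      refine (pow_dvd_pow _ hle).trans ?_
      rw [pow_add]
      exact mul_dvd_mul (Dvd.intro_left _ rfl) (ih _ hss)
    have h3 : PowerSeries.X ^ ρ B ∣ rankSeries ρ B * Finset.moebius (rankLogSeries ρ) B := by
      rw [← h1, eq_sub_of_add_eq hB]
      exact dvd_sub ((Dvd.intro_left _ rfl).mul_left _) h2
    have hu : IsUnit (rankSeries ρ B) := by
      rw [PowerSeries.isUnit_iff_constantCoeff, constantCoeff_rankSeries h0]
      exact isUnit_one
    exact hu.dvd_mul_left.1 h3

theorem rankSeries_eq_mul_of_split {ρ : Finset E → ℕ} (p : E → Prop) [DecidablePred p]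
    (B : Finset E)
    (hρ : ∀ A ⊆ B, ρ A = ρ (A.filter p) + ρ (A.filter fun e => ¬ p e)) :
    rankSeries ρ B = rankSeries ρ (B.filter p) * rankSeries ρ (B.filter fun e => ¬ p e) := by
  rw [rankSeries, rankSeries, rankSeries, Finset.sum_mul_sum, ← Finset.sum_product']
  refine Finset.sum_bij' (fun A _ => (A.filter p, A.filter fun e => ¬ p e))
    (fun P _ => P.1 ∪ P.2) ?_ ?_ ?_ ?_ ?_
  · intro A hA
    rw [Finset.mem_powerset] at hA
    simp only [Finset.mem_product, Finset.mem_powerset]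
    exact ⟨Finset.filter_subset_filter _ hA, Finset.filter_subset_filter _ hA⟩
  · intro P hP
    simp only [Finset.mem_product, Finset.mem_powerset] at hP ⊢
    exact Finset.union_subset (hP.1.trans (Finset.filter_subset _ _))
      (hP.2.trans (Finset.filter_subset _ _))
  · intro A _
    exact Finset.filter_union_filter_not_eq p A
  · rintro ⟨A, C⟩ hP
    simp only [Finset.mem_product, Finset.mem_powerset] at hP
    have hA : ∀ e ∈ A, p e := fun e he => (Finset.mem_filter.1 (hP.1 he)).2
    have hC : ∀ e ∈ C, ¬ p e := fun e he => (Finset.mem_filter.1 (hP.2 he)).2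
    simp only [Finset.filter_union, Finset.filter_true_of_mem hA, Finset.filter_true_of_mem hC,
      Finset.filter_false_of_mem hC, Finset.union_empty,
      Finset.filter_false_of_mem (p := fun e => ¬ p e) fun e he => not_not.2 (hA e he),
      Finset.empty_union]
  · intro A hA
    rw [Finset.mem_powerset] at hA
    rw [hρ A hA, pow_add, ← Finset.card_filter_add_card_filter_not (s := A) p, pow_add]
    ring

/-- The rank series factors along the splitting, so by the Leibniz rule its logarithmic derivative
is additive. -/
theorem moebius_rankLogSeries_eq_zero_of_split {ρ : Finset E → ℕ} (h0 : ∀ A, ρ A = 0 ↔ A = ∅)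
    (p : E → Prop) [DecidablePred p] (B : Finset E)
    (hρ : ∀ A ⊆ B, ρ A = ρ (A.filter p) + ρ (A.filter fun e => ¬ p e))
    (h1 : (B.filter p).Nonempty) (h2 : (B.filter fun e => ¬ p e).Nonempty) :
    Finset.moebius (rankLogSeries ρ) B = 0 := by
  refine Finset.moebius_eq_zero_of_additive _ p B (fun A hA => ?_) h1 h2
  have hne : ∀ C, rankSeries ρ C ≠ 0 := fun C h => by
    have := constantCoeff_rankSeries h0 C
    rw [h, map_zero] at this
    exact zero_ne_one this
  have hA' := rankSeries_eq_mul_of_split p A fun C hC => hρ C (hC.trans hA)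
  have e0 := rankSeries_mul_rankLogSeries h0 A
  have e1 := rankSeries_mul_rankLogSeries h0 (A.filter p)
  have e2 := rankSeries_mul_rankLogSeries h0 (A.filter fun e => ¬ p e)
  refine mul_left_cancel₀ (hne A) ?_
  rw [e0, hA', Derivation.leibniz, smul_eq_mul, smul_eq_mul]
  linear_combination (-rankSeries ρ (A.filter fun e => ¬ p e)) * e1
    - rankSeries ρ (A.filter p) * e2

theorem moebius_rankLogSeries_image {E' : Type*} [DecidableEq E'] {ρ : Finset E → ℕ}
    {ρ' : Finset E' → ℕ} (f : E → E') (B : Finset E) (hf : Set.InjOn f B)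
    (hρ : ∀ A ⊆ B, ρ' (A.image f) = ρ A) :
    Finset.moebius (rankLogSeries ρ') (B.image f) = Finset.moebius (rankLogSeries ρ) B := by
  refine Finset.moebius_image _ _ f B hf fun A hA => ?_
  rw [rankLogSeries, rankLogSeries,
    rankSeries_image f A (hf.mono hA) fun C hC => hρ C (hC.trans hA)]

end RankSeries

/-! ### Graphic rank as the dimension of a span, and connected edge sets. -/

section EdgeRank

variable {E V : Type*}

/-- The span of the differences of the endpoints of the edges in `A`, for the multigraph with
edges `E`, vertices `V` and endpoint maps `s`, `t`. -/
noncomputable def edgeSpan (s t : E → V) (A : Finset E) : Submodule ℚ (V →₀ ℚ) :=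
  Submodule.span ℚ ((fun e => Finsupp.single (s e) 1 - Finsupp.single (t e) 1) '' (A : Set E))

/-- The rank of an edge set in the graphic matroid. -/
noncomputable def edgeRank (s t : E → V) (A : Finset E) : ℕ :=
  Module.finrank ℚ (edgeSpan s t A)

/-- The edge set `B` cannot be split into two nonempty parts without common vertices. -/
def EdgeConnected (s t : E → V) (B : Finset E) : Prop :=
  ∀ p : V → Prop, (∀ e ∈ B, p (s e) ↔ p (t e)) → (∀ e ∈ B, p (s e)) ∨ ∀ e ∈ B, ¬ p (s e)

instance finiteDimensional_edgeSpan (s t : E → V) (A : Finset E) :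
    FiniteDimensional ℚ (edgeSpan s t A) :=
  FiniteDimensional.span_of_finite ℚ (A.finite_toSet.image _)

theorem sub_mem_edgeSpan (s t : E → V) {A : Finset E} {e : E} (he : e ∈ A) :
    Finsupp.single (s e) 1 - Finsupp.single (t e) 1 ∈ edgeSpan s t A :=
  Submodule.subset_span ⟨e, he, rfl⟩

theorem edgeSpan_union [DecidableEq E] (s t : E → V) (A B : Finset E) :
    edgeSpan s t (A ∪ B) = edgeSpan s t A ⊔ edgeSpan s t B := by
  rw [edgeSpan, Finset.coe_union, Set.image_union, Submodule.span_union]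
  rfl

theorem edgeRank_union_le [DecidableEq E] (s t : E → V) (A B : Finset E) :
    edgeRank s t (A ∪ B) ≤ edgeRank s t A + edgeRank s t B := by
  rw [edgeRank, edgeSpan_union]
  exact Submodule.finrank_add_le_finrank_add_finrank _ _

theorem edgeRank_empty (s t : E → V) : edgeRank s t ∅ = 0 := by
  rw [edgeRank, edgeSpan, Finset.coe_empty, Set.image_empty, Submodule.span_empty, finrank_bot]

theorem edgeRank_eq_zero_iff {s t : E → V} (hst : ∀ e, s e ≠ t e) (A : Finset E) :
    edgeRank s t A = 0 ↔ A = ∅ := by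
  constructor
  · intro h
    rw [edgeRank, Submodule.finrank_eq_zero] at h
    refine Finset.eq_empty_of_forall_notMem fun e he => hst e ?_
    have := sub_mem_edgeSpan s t he
    rw [h, Submodule.mem_bot, sub_eq_zero] at this
    exact Finsupp.single_left_injective one_ne_zero this
  · rintro rfl
    exact edgeRank_empty s t

theorem edgeSpan_le_supported (s t : E → V) (A : Finset E) (p : V → Prop)
    (h : ∀ e ∈ A, p (s e) ∧ p (t e)) : edgeSpan s t A ≤ Finsupp.supported ℚ ℚ {v | p v} := by
  rw [edgeSpan, Submodule.span_le]
  rintro _ ⟨e, he, rfl⟩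
  exact Submodule.sub_mem _ (Finsupp.single_mem_supported ℚ _ (h e he).1)
    (Finsupp.single_mem_supported ℚ _ (h e he).2)

theorem edgeRank_eq_add_of_split (s t : E → V) (p : V → Prop) [DecidablePred p]
    (A : Finset E) (h : ∀ e ∈ A, p (s e) ↔ p (t e)) :
    edgeRank s t A = edgeRank s t (A.filter fun e => p (s e))
      + edgeRank s t (A.filter fun e => ¬ p (s e)) := by
  classical
  have hd : Disjoint (edgeSpan s t (A.filter fun e => p (s e)))
      (edgeSpan s t (A.filter fun e => ¬ p (s e))) := by
    refine Disjoint.mono (edgeSpan_le_supported s t _ p fun e he => ?_)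
      (edgeSpan_le_supported s t _ (fun v => ¬ p v) fun e he => ?_)
      (Finsupp.disjoint_supported_supported
        (Set.disjoint_left.2 fun v (hv : p v) (hv' : ¬ p v) => hv' hv))
    · rw [Finset.mem_filter] at he
      exact ⟨he.2, (h e he.1).1 he.2⟩
    · rw [Finset.mem_filter] at he
      exact ⟨he.2, fun h' => he.2 ((h e he.1).2 h')⟩
  have hA : A = (A.filter fun e => p (s e)) ∪ A.filter fun e => ¬ p (s e) :=
    (Finset.filter_union_filter_not_eq _ A).symm
  conv_lhs => rw [hA, edgeRank, edgeSpan_union]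
  rw [edgeRank, edgeRank, ← Submodule.finrank_sup_add_finrank_inf_eq, hd.eq_bot, finrank_bot,
    add_zero]

theorem moebius_rankLogSeries_eq_zero_of_not_edgeConnected [DecidableEq E] {s t : E → V}
    (hst : ∀ e, s e ≠ t e) {B : Finset E} (hB : ¬ EdgeConnected s t B) :
    Finset.moebius (rankLogSeries (edgeRank s t)) B = 0 := by
  classical
  simp only [EdgeConnected, not_forall, not_or, not_not] at hB
  obtain ⟨p, hp, ⟨e, he, he'⟩, e', he2, he2'⟩ := hB
  exact moebius_rankLogSeries_eq_zero_of_split (edgeRank_eq_zero_iff hst) (fun e => p (s e)) B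
    (fun A hA => edgeRank_eq_add_of_split s t p A fun e he => hp e (hA he))
    ⟨e', Finset.mem_filter.2 ⟨he2, he2'⟩⟩ ⟨e, Finset.mem_filter.2 ⟨he, he'⟩⟩

/-- Being congruent to the basis vector of `s e₀` modulo the span passes along every edge of `B`, so
connectedness spreads it to all of `B`. -/
theorem single_sub_single_mem_edgeSpan {s t : E → V} {B : Finset E} (hB : EdgeConnected s t B)
    {e₀ e : E} (he₀ : e₀ ∈ B) (he : e ∈ B) :
    Finsupp.single (s e) 1 - Finsupp.single (s e₀) 1 ∈ edgeSpan s t B := by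
  have hp : ∀ e ∈ B, Finsupp.single (s e) 1 - Finsupp.single (s e₀) 1 ∈ edgeSpan s t B
      ↔ Finsupp.single (t e) 1 - Finsupp.single (s e₀) 1 ∈ edgeSpan s t B := fun e he => by
    have h1 := sub_mem_edgeSpan s t he
    constructor
    · intro h
      simpa using Submodule.sub_mem _ h h1
    · intro h
      simpa using Submodule.add_mem _ h h1
  rcases hB (fun v => Finsupp.single v 1 - Finsupp.single (s e₀) 1 ∈ edgeSpan s t B) hp with h | h
  · exact h e he
  · exact absurd (by rw [sub_self]; exact Submodule.zero_mem _) (h e₀ he₀)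

/-- A connected edge set has at most one more vertex than its rank. -/
theorem card_le_edgeRank_add_one {s t : E → V} {B : Finset E} (hB : EdgeConnected s t B)
    (hne : B.Nonempty) (W : Finset V) (hW : ∀ v ∈ W, ∃ e ∈ B, v = s e ∨ v = t e) :
    W.card ≤ edgeRank s t B + 1 := by
  obtain ⟨e₀, he₀⟩ := hne
  set v₀ : V →₀ ℚ := Finsupp.single (s e₀) 1 with hv₀
  -- Adjoining one basis vector to the span captures the basis vectors of all vertices in `W`, which
  -- are independent.
  have hs : ∀ e ∈ B, Finsupp.single (s e) 1 ∈ edgeSpan s t B ⊔ Submodule.span ℚ {v₀} := by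
    intro e he
    have h1 := Submodule.mem_sup_left (T := Submodule.span ℚ {v₀})
      (single_sub_single_mem_edgeSpan hB he₀ he)
    have h2 := Submodule.mem_sup_right (S := edgeSpan s t B)
      (Submodule.mem_span_singleton_self (R := ℚ) v₀)
    simpa [hv₀] using Submodule.add_mem _ h1 h2
  have hall : ∀ v ∈ W, Finsupp.single v 1 ∈ edgeSpan s t B ⊔ Submodule.span ℚ {v₀} := by
    intro v hv
    obtain ⟨e, he, rfl | rfl⟩ := hW v hv
    · exact hs e he
    · have h1 := Submodule.mem_sup_left (T := Submodule.span ℚ {v₀}) (sub_mem_edgeSpan s t he)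
      simpa using Submodule.sub_mem _ (hs e he) h1
  have hli : LinearIndependent ℚ (fun v : W => (Finsupp.single (v : V) 1 : V →₀ ℚ)) :=
    (Finsupp.linearIndependent_single_one ℚ V).comp _ Subtype.val_injective
  have hle : Submodule.span ℚ (Set.range fun v : W => (Finsupp.single (v : V) 1 : V →₀ ℚ))
      ≤ edgeSpan s t B ⊔ Submodule.span ℚ {v₀} := by
    rw [Submodule.span_le]
    rintro _ ⟨v, rfl⟩
    exact hall v v.2
  have h1 := Submodule.finrank_mono hle
  rw [finrank_span_eq_card hli, Fintype.card_coe] at h1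
  refine h1.trans ((Submodule.finrank_add_le_finrank_add_finrank _ _).trans ?_)
  have : Module.finrank ℚ (Submodule.span ℚ {v₀}) ≤ 1 := by
    simpa using finrank_span_le_card (R := ℚ) ({v₀} : Set (V →₀ ℚ))
  exact Nat.add_le_add_left this _

section Transport

variable {E' V' : Type*} [DecidableEq E'] {s t : E → V} {s' t' : E' → V'} {fE : E → E'}
  {fV : V → V'}

theorem edgeRank_image_le (A : Finset E) (hs : ∀ e ∈ A, s' (fE e) = fV (s e))
    (ht : ∀ e ∈ A, t' (fE e) = fV (t e)) :
    edgeRank s' t' (A.image fE) ≤ edgeRank s t A := by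
  have : edgeSpan s' t' (A.image fE) = (edgeSpan s t A).map (Finsupp.lmapDomain ℚ ℚ fV) := by
    rw [edgeSpan, edgeSpan, Submodule.map_span, Finset.coe_image, Set.image_image,
      Set.image_image]
    congr 1
    refine Set.image_congr fun e he => ?_
    rw [map_sub, Finsupp.lmapDomain_apply, Finsupp.lmapDomain_apply, Finsupp.mapDomain_single,
      Finsupp.mapDomain_single, hs e he, ht e he]
  rw [edgeRank, edgeRank, this]
  exact Submodule.finrank_map_le _ _

/-- The inequality `edgeRank_image_le` is used in both directions; `gV` undoes `fV` on the endpoints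
of `A`. -/
theorem edgeRank_image {fE : E → E'} {fV : V → V'} {gV : V' → V} (A : Finset E)
    (hs : ∀ e ∈ A, s' (fE e) = fV (s e)) (ht : ∀ e ∈ A, t' (fE e) = fV (t e))
    (hgs : ∀ e ∈ A, gV (fV (s e)) = s e) (hgt : ∀ e ∈ A, gV (fV (t e)) = t e)
    (hinj : Set.InjOn fE A) :
    edgeRank s' t' (A.image fE) = edgeRank s t A := by
  classical
  refine le_antisymm (edgeRank_image_le A hs ht) ?_
  rcases A.eq_empty_or_nonempty with rfl | ⟨e₀, he₀⟩
  · rw [edgeRank_empty]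
    exact Nat.zero_le _
  have : Nonempty E := ⟨e₀⟩
  have hinv : ∀ e ∈ A, Function.invFunOn fE (A : Set E) (fE e) = e := fun e he =>
    hinj.leftInvOn_invFunOn he
  have hA : (A.image fE).image (Function.invFunOn fE (A : Set E)) = A := by
    rw [Finset.image_image]
    conv_rhs => rw [← Finset.image_id (s := A)]
    exact Finset.image_congr fun e he => hinv e he
  conv_lhs => rw [← hA]
  refine edgeRank_image_le (fV := gV) _ ?_ ?_
  · intro e' he'
    obtain ⟨e, he, rfl⟩ := Finset.mem_image.1 he'
    rw [hinv e he, hs e he, hgs e he]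
  · intro e' he'
    obtain ⟨e, he, rfl⟩ := Finset.mem_image.1 he'
    rw [hinv e he, ht e he, hgt e he]

theorem edgeConnected_image_iff {fE : E → E'} {fV : V → V'} {gV : V' → V} (B : Finset E)
    (hs : ∀ e ∈ B, s' (fE e) = fV (s e)) (ht : ∀ e ∈ B, t' (fE e) = fV (t e))
    (hgs : ∀ e ∈ B, gV (fV (s e)) = s e) (hgt : ∀ e ∈ B, gV (fV (t e)) = t e) :
    EdgeConnected s' t' (B.image fE) ↔ EdgeConnected s t B := by
  constructor
  · intro h p hp
    have := h (fun v => p (gV v))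
    simp only [Finset.forall_mem_image] at this
    refine (this fun e he => ?_).imp (fun h e he => ?_) fun h e he => ?_
    · rw [hs e he, ht e he, hgs e he, hgt e he]
      exact hp e he
    · simpa [hs e he, hgs e he] using h he
    · simpa [hs e he, hgs e he] using h he
  · intro h p hp
    simp only [Finset.forall_mem_image] at hp ⊢
    refine (h (fun v => p (fV v)) fun e he => ?_).imp (fun h e he => ?_) fun h e he => ?_
    · rw [← hs e he, ← ht e he]
      exact hp he
    · rw [hs e he]; exact h e he
    · rw [hs e he]; exact h e he

end Transport

end EdgeRank

/-! ### Whitney's expansion of the chromatic polynomial. -/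

section Whitney

variable {E V : Type*}

/-- The equivalence relation of lying in the same component of the edge set `A`. -/
def edgeSetoid (s t : E → V) (A : Finset E) : Setoid V :=
  Relation.EqvGen.setoid fun u v => ∃ e ∈ A, s e = u ∧ t e = v

theorem edgeSetoid_mk_eq (s t : E → V) {A : Finset E} {e : E} (he : e ∈ A) :
    Quotient.mk (edgeSetoid s t A) (s e) = Quotient.mk (edgeSetoid s t A) (t e) :=
  Quotient.sound (Relation.EqvGen.rel _ _ ⟨e, he, rfl, rfl⟩)

theorem edgeSetoid_eq_of_rel {α : Type*} {s t : E → V} {A : Finset E} {f : V → α}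
    (hf : ∀ e ∈ A, f (s e) = f (t e)) {u v : V} (h : edgeSetoid s t A u v) : f u = f v := by
  induction h with
  | rel u v h => obtain ⟨e, he, rfl, rfl⟩ := h; exact hf e he
  | refl => rfl
  | symm _ _ _ ih => exact ih.symm
  | trans _ _ _ _ _ ih1 ih2 => exact ih1.trans ih2

theorem single_sub_single_mem_edgeSpan_of_rel {s t : E → V} {A : Finset E} {u v : V}
    (h : edgeSetoid s t A u v) :
    Finsupp.single u 1 - Finsupp.single v 1 ∈ edgeSpan s t A := by
  have := edgeSetoid_eq_of_rel (f := fun v => (edgeSpan s t A).mkQ (Finsupp.single v 1))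
    (fun e he => by
      rw [Submodule.mkQ_apply, Submodule.mkQ_apply, Submodule.Quotient.eq]
      exact sub_mem_edgeSpan s t he) h
  simpa only [Submodule.mkQ_apply, Submodule.Quotient.eq] using this

/-- A vector whose coefficients sum to zero on each component is the combination of the differences
between each vertex and the representative of its component. Rank-nullity then turns the graphic
rank into `|V|` minus the number of components. -/
theorem ker_lmapDomain_mk_edgeSetoid (s t : E → V) (A : Finset E) :
    LinearMap.ker (Finsupp.lmapDomain ℚ ℚ (Quotient.mk (edgeSetoid s t A)))
      = edgeSpan s t A := by
  apply le_antisymm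
  · intro x hx
    rw [LinearMap.mem_ker, Finsupp.lmapDomain_apply] at hx
    have h1 : Finsupp.mapDomain (fun v => (Quotient.mk (edgeSetoid s t A) v).out) x = 0 := by
      have := Finsupp.mapDomain_comp (f := Quotient.mk (edgeSetoid s t A)) (g := Quotient.out)
        (v := x)
      rw [hx, Finsupp.mapDomain_zero] at this
      exact this
    have h2 : x = x.sum fun v a => a • (Finsupp.single v (1 : ℚ)
        - Finsupp.single (Quotient.mk (edgeSetoid s t A) v).out 1) := by
      have h3 : x.sum (fun v a => a • (Finsupp.single v (1 : ℚ)
          - Finsupp.single (Quotient.mk (edgeSetoid s t A) v).out 1))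
          = x.sum Finsupp.single
            - Finsupp.mapDomain (fun v => (Quotient.mk (edgeSetoid s t A) v).out) x := by
        rw [Finsupp.mapDomain, ← Finsupp.sum_sub]
        refine Finsupp.sum_congr fun v _ => ?_
        rw [smul_sub, Finsupp.smul_single_one, Finsupp.smul_single_one]
      rw [h3, h1, sub_zero, Finsupp.sum_single]
    rw [h2]
    exact Submodule.sum_mem _ fun v _ => Submodule.smul_mem _ _
      (single_sub_single_mem_edgeSpan_of_rel (Setoid.symm' _ (Quotient.mk_out v)))
  · rw [edgeSpan, Submodule.span_le]
    rintro _ ⟨e, he, rfl⟩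
    rw [SetLike.mem_coe, LinearMap.mem_ker, map_sub, Finsupp.lmapDomain_apply,
      Finsupp.lmapDomain_apply, Finsupp.mapDomain_single, Finsupp.mapDomain_single,
      edgeSetoid_mk_eq s t he, sub_self]

theorem card_quotient_edgeSetoid_add_edgeRank [Finite V] (s t : E → V) (A : Finset E) :
    Nat.card (Quotient (edgeSetoid s t A)) + edgeRank s t A = Nat.card V := by
  have := Fintype.ofFinite V
  have := Fintype.ofFinite (Quotient (edgeSetoid s t A))
  have h := LinearMap.finrank_range_add_finrank_ker
    (Finsupp.lmapDomain ℚ ℚ (Quotient.mk (edgeSetoid s t A)))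
  have hsurj : Function.Surjective (Finsupp.lmapDomain ℚ ℚ (Quotient.mk (edgeSetoid s t A))) :=
    Finsupp.mapDomain_surjective Quotient.mk_surjective
  rw [LinearMap.range_eq_top.2 hsurj, finrank_top, ker_lmapDomain_mk_edgeSetoid,
    Module.finrank_finsupp_self, Module.finrank_finsupp_self] at h
  rw [Nat.card_eq_fintype_card, Nat.card_eq_fintype_card]
  exact h

theorem edgeRank_le_card [Finite V] (s t : E → V) (A : Finset E) :
    edgeRank s t A ≤ Nat.card V :=
  (card_quotient_edgeSetoid_add_edgeRank s t A) ▸ Nat.le_add_left _ _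

/-- The number of functions to `n` colors that are constant along the edges in `A`. -/
theorem card_constant_along [Finite V] (s t : E → V) (A : Finset E) (n : ℕ) :
    Nat.card {c : V → Fin n // ∀ e ∈ A, c (s e) = c (t e)}
      = n ^ (Nat.card V - edgeRank s t A) := by
  have e : {c : V → Fin n // ∀ e ∈ A, c (s e) = c (t e)}
      ≃ (Quotient (edgeSetoid s t A) → Fin n) :=
    { toFun := fun c => Quotient.lift c.1 fun _ _ h => edgeSetoid_eq_of_rel c.2 h
      invFun := fun f => ⟨fun v => f (Quotient.mk _ v), fun _ he =>
        congrArg f (edgeSetoid_mk_eq s t he)⟩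
      left_inv := fun c => rfl
      right_inv := fun f => by
        ext x
        induction x using Quotient.inductionOn with | _ a => rfl }
  rw [Nat.card_congr e, Nat.card_fun, Nat.card_fin,
    ← card_quotient_edgeSetoid_add_edgeRank s t A, Nat.add_sub_cancel]

/-- `s` and `t` are the endpoint maps of a family of edges that covers exactly the edges of
`G`. -/
def SimpleGraph.IsEdgeFamily (G : SimpleGraph V) (s t : E → V) : Prop :=
  ∀ u v, G.Adj u v ↔ ∃ e, s e = u ∧ t e = v ∨ s e = v ∧ t e = u

theorem SimpleGraph.IsEdgeFamily.ne {G : SimpleGraph V} {s t : E → V}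
    (h : G.IsEdgeFamily s t) (e : E) : s e ≠ t e :=
  ((h (s e) (t e)).2 ⟨e, Or.inl ⟨rfl, rfl⟩⟩).ne

/-- Inclusion-exclusion over the monochromatic edges. Parallel edges do no harm, since they impose
the same condition. -/
theorem SimpleGraph.IsEdgeFamily.card_coloring [Finite V] [Fintype E] {G : SimpleGraph V}
    {s t : E → V} (h : G.IsEdgeFamily s t) (n : ℕ) :
    (Nat.card (G.Coloring (Fin n)) : ℤ)
      = ∑ A ∈ (Finset.univ : Finset E).powerset,
        (-1) ^ A.card * (n : ℤ) ^ (Nat.card V - edgeRank s t A) := by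
  classical
  have := Fintype.ofFinite V
  have e : G.Coloring (Fin n) ≃ {c : V → Fin n // ∀ e, c (s e) ≠ c (t e)} :=
    { toFun := fun c => ⟨c, fun e => c.valid ((h _ _).2 ⟨e, Or.inl ⟨rfl, rfl⟩⟩)⟩
      invFun := fun c => SimpleGraph.Coloring.mk c.1 fun {u v} huv => by
        obtain ⟨e, ⟨rfl, rfl⟩ | ⟨rfl, rfl⟩⟩ := (h _ _).1 huv
        · exact c.2 e
        · exact (c.2 e).symm
      left_inv := fun c => by ext; rfl
      right_inv := fun c => rfl }
  have hi := Finset.inclusion_exclusion_card_inf_compl (Finset.univ : Finset E)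
    (fun e => Finset.univ.filter fun c : V → Fin n => c (s e) = c (t e))
  have hl : (Finset.univ : Finset E).inf
      (fun e => (Finset.univ.filter fun c : V → Fin n => c (s e) = c (t e))ᶜ)
      = Finset.univ.filter fun c : V → Fin n => ∀ e, c (s e) ≠ c (t e) := by
    ext c
    simp [Finset.mem_inf]
  rw [hl] at hi
  rw [Nat.card_congr e, Nat.card_eq_fintype_card, Fintype.card_subtype, hi]
  refine Finset.sum_congr rfl fun A _ => ?_
  have hr : A.inf (fun e => Finset.univ.filter fun c : V → Fin n => c (s e) = c (t e))
      = Finset.univ.filter fun c : V → Fin n => ∀ e ∈ A, c (s e) = c (t e) := by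
    ext c
    simp [Finset.mem_inf]
  rw [hr, ← Fintype.card_subtype, ← Nat.card_eq_fintype_card, card_constant_along]
  push_cast
  rfl

theorem SimpleGraph.IsEdgeFamily.chromaticPolynomial_eq [Finite V] [Fintype E]
    {G : SimpleGraph V} {s t : E → V} (h : G.IsEdgeFamily s t) :
    G.chromaticPolynomial = ∑ A ∈ (Finset.univ : Finset E).powerset,
        C ((-1 : ℚ) ^ A.card) * X ^ (Nat.card V - edgeRank s t A) := by
  refine G.existsUnique_chromaticPolynomial.unique G.chromaticPolynomial_eval fun n => ?_
  have := congrArg (Int.cast : ℤ → ℚ) (h.card_coloring n)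
  push_cast at this
  rw [this, Polynomial.eval_finsetSum]
  simp only [eval_mul, eval_C, eval_pow, eval_X]

theorem SimpleGraph.IsEdgeFamily.coeff_chromaticPolynomial [Finite V] [Fintype E]
    {G : SimpleGraph V} {s t : E → V} (h : G.IsEdgeFamily s t) {r : ℕ} (hr : r ≤ Nat.card V) :
    G.chromaticPolynomial.coeff (Nat.card V - r)
      = PowerSeries.coeff r (rankSeries (edgeRank s t) Finset.univ) := by
  rw [h.chromaticPolynomial_eq, rankSeries, finsetSum_coeff, map_sum]
  refine Finset.sum_congr rfl fun A _ => ?_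
  have h1 := edgeRank_le_card s t A
  have h2 : (Nat.card V - r = Nat.card V - edgeRank s t A) ↔ r = edgeRank s t A := by omega
  have h3 : ((-1 : PowerSeries ℚ)) ^ A.card = PowerSeries.C ((-1) ^ A.card) := by simp
  rw [coeff_C_mul, h3, PowerSeries.coeff_C_mul, coeff_X_pow, PowerSeries.coeff_X_pow]
  simp only [h2]

theorem SimpleGraph.IsEdgeFamily.coeff_card_chromaticPolynomial [Finite V] [Fintype E]
    {G : SimpleGraph V} {s t : E → V} (h : G.IsEdgeFamily s t) :
    G.chromaticPolynomial.coeff (Nat.card V) = 1 := by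
  have h1 := h.coeff_chromaticPolynomial (Nat.zero_le _)
  rw [Nat.sub_zero, PowerSeries.coeff_zero_eq_constantCoeff_apply,
    constantCoeff_rankSeries (edgeRank_eq_zero_iff h.ne)] at h1
  exact h1

theorem SimpleGraph.IsEdgeFamily.natDegree_chromaticPolynomial [Finite V] [Fintype E]
    {G : SimpleGraph V} {s t : E → V} (h : G.IsEdgeFamily s t) :
    G.chromaticPolynomial.natDegree = Nat.card V := by
  refine natDegree_eq_of_le_of_coeff_ne_zero ?_ ?_
  · rw [h.chromaticPolynomial_eq]
    exact natDegree_sum_le_of_forall_le _ _ fun A _ =>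
      (natDegree_C_mul_X_pow_le _ _).trans (Nat.sub_le _ _)
  · rw [h.coeff_card_chromaticPolynomial]
    exact one_ne_zero

theorem SimpleGraph.IsEdgeFamily.chromaticPolynomial_ne_zero [Finite V] [Fintype E]
    {G : SimpleGraph V} {s t : E → V} (h : G.IsEdgeFamily s t) :
    G.chromaticPolynomial ≠ 0 := fun h0 => by
  have := h.coeff_card_chromaticPolynomial
  rw [h0, coeff_zero] at this
  exact zero_ne_one this

theorem SimpleGraph.IsEdgeFamily.codegreeCoeff_chromaticPolynomial [Finite V] [Fintype E]
    {G : SimpleGraph V} {s t : E → V} (h : G.IsEdgeFamily s t) (r : ℕ) :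
    codegreeCoeff G.chromaticPolynomial r
      = PowerSeries.coeff r (rankSeries (edgeRank s t) Finset.univ) := by
  rw [codegreeCoeff, h.natDegree_chromaticPolynomial]
  split_ifs with hr
  · exact h.coeff_chromaticPolynomial hr
  -- No edge set has rank above `|V|`, which agrees with the default value `0` of `codegreeCoeff`.
  · rw [rankSeries, map_sum, Finset.sum_eq_zero]
    intro A _
    have h1 := edgeRank_le_card s t A
    have h3 : ((-1 : PowerSeries ℚ)) ^ A.card = PowerSeries.C ((-1) ^ A.card) := by simp
    rw [h3, PowerSeries.coeff_C_mul, PowerSeries.coeff_X_pow, if_neg (by omega), mul_zero]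

end Whitney

/-- Choosing one vertex over each value of `f` reduces this to counting vertices; `f` will be a
coordinate. -/
theorem card_le_edgeRank_add_one_of_forall {E V X : Type*} {s t : E → V} {B : Finset E}
    (hB : EdgeConnected s t B) (hne : B.Nonempty) (f : V → X) (U : Finset X)
    (hU : ∀ x ∈ U, ∃ e ∈ B, f (s e) = x ∨ f (t e) = x) :
    U.card ≤ edgeRank s t B + 1 := by
  classical
  have h : ∀ x : U, ∃ v, (∃ e ∈ B, v = s e ∨ v = t e) ∧ f v = x := by
    rintro ⟨x, hx⟩
    obtain ⟨e, he, h | h⟩ := hU x hx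
    · exact ⟨s e, ⟨e, he, Or.inl rfl⟩, h⟩
    · exact ⟨t e, ⟨e, he, Or.inr rfl⟩, h⟩
  choose w hw hfw using h
  have hinj : Function.Injective w := fun x y hxy =>
    Subtype.ext ((hfw x).symm.trans ((congrArg f hxy).trans (hfw y)))
  have := card_le_edgeRank_add_one hB hne (Finset.univ.image w) fun v hv => by
    obtain ⟨x, -, rfl⟩ := Finset.mem_image.1 hv
    exact hw x
  rwa [Finset.card_image_of_injective _ hinj, Finset.card_univ, Fintype.card_coe] at this

/-! ### Connected edge sets in the lattice. -/

section Lattice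

open scoped Fin.CommRing

variable {k n : ℕ}

/-- The edge `(x, i)` of the `k`-dimensional lattice over `R` joins `x` to the vertex obtained by
adding `1` to the coordinate `i`. -/
def latticeTgt {R : Type*} [Add R] [Zero R] [One R] (e : (Fin k → R) × Fin k) : Fin k → R :=
  e.1 + Pi.single e.2 1

theorem latticeTgt_apply {R : Type*} [AddMonoid R] [One R] (e : (Fin k → R) × Fin k)
    (i : Fin k) : latticeTgt e i = if i = e.2 then e.1 i + 1 else e.1 i := by
  rw [latticeTgt, Pi.add_apply, Pi.single_apply]
  split_ifs <;> simp

theorem latticeTgt_ne {R : Type*} [AddMonoid R] [IsLeftCancelAdd R] [One R] [NeZero (1 : R)]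
    (e : (Fin k → R) × Fin k) : e.1 ≠ latticeTgt e := fun h => by
  have := congrFun h e.2
  rw [latticeTgt_apply, if_pos rfl, left_eq_add] at this
  exact one_ne_zero this

theorem le_latticeTgt (e : (Fin k → ℕ) × Fin k) (i : Fin k) : e.1 i ≤ latticeTgt e i := by
  rw [latticeTgt_apply]
  split_ifs <;> omega

theorem latticeTgt_le (e : (Fin k → ℕ) × Fin k) (i : Fin k) : latticeTgt e i ≤ e.1 i + 1 := by
  rw [latticeTgt_apply]
  split_ifs <;> omega

/-- The rank function of the edge sets of the lattice. -/
noncomputable abbrev latticeRank {R : Type*} [Add R] [Zero R] [One R]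
    (B : Finset ((Fin k → R) × Fin k)) : ℕ :=
  edgeRank Prod.fst latticeTgt B

/-- The coordinates of the vertices of a connected edge set form an interval. -/
theorem exists_coordinate_eq {B : Finset ((Fin k → ℕ) × Fin k)}
    (hB : EdgeConnected Prod.fst latticeTgt B) {i : Fin k} {a : ℕ}
    {e₀ e₁ : (Fin k → ℕ) × Fin k} (he₀ : e₀ ∈ B) (h₀ : e₀.1 i < a) (he₁ : e₁ ∈ B)
    (h₁ : a ≤ latticeTgt e₁ i) : ∃ e ∈ B, e.1 i = a ∨ latticeTgt e i = a := by
  by_contra! hcon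
  -- An edge raises the coordinate by at most `1`, so if the value `a` is missed, no edge passes
  -- from below `a` to above it.
  have hp : ∀ e ∈ B, e.1 i < a ↔ latticeTgt e i < a := fun e he => by
    have h1 := le_latticeTgt e i
    have h2 := latticeTgt_le e i
    have h3 := hcon e he
    omega
  rcases hB (fun x => x i < a) hp with h | h
  · exact absurd ((hp e₁ he₁).1 (h e₁ he₁)) (not_lt.2 h₁)
  · exact h e₀ he₀ h₀

/-- All values from `0` to `latticeTgt e i` occur as coordinates, and their number is at most the
rank plus one. -/
theorem latticeTgt_le_latticeRank {B : Finset ((Fin k → ℕ) × Fin k)}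
    (hB : EdgeConnected Prod.fst latticeTgt B) {i : Fin k} (h0 : ∃ e ∈ B, e.1 i = 0)
    {e : (Fin k → ℕ) × Fin k} (he : e ∈ B) : latticeTgt e i ≤ latticeRank B := by
  obtain ⟨e₀, he₀, h₀⟩ := h0
  have := card_le_edgeRank_add_one_of_forall hB ⟨e, he⟩ (fun x => x i)
    (Finset.range (latticeTgt e i + 1)) fun a ha => by
      rw [Finset.mem_range] at ha
      rcases Nat.eq_zero_or_pos a with rfl | hpos
      · exact ⟨e₀, he₀, Or.inl h₀⟩
      · exact exists_coordinate_eq hB he₀ (by omega) he (by omega)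
  rw [Finset.card_range] at this
  exact Nat.le_of_succ_le_succ this

/-- The nonempty connected edge sets of rank at most `j` in `ℕ^k` whose least coordinates in all
directions are `0`; their vertices lie in the box `[0, j]^k`. -/
noncomputable def rootedEdgeSets (k j : ℕ) : Finset (Finset ((Fin k → ℕ) × Fin k)) := by
  classical
  exact (Fintype.piFinset (fun _ => Finset.range (j + 1)) ×ˢ Finset.univ).powerset.filter
    fun B : Finset ((Fin k → ℕ) × Fin k) => B.Nonempty ∧ EdgeConnected Prod.fst latticeTgt B ∧
      latticeRank B ≤ j ∧ ∀ i, ∃ e ∈ B, e.1 i = 0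

theorem mem_rootedEdgeSets {j : ℕ} {B : Finset ((Fin k → ℕ) × Fin k)} :
    B ∈ rootedEdgeSets k j ↔ B.Nonempty ∧ EdgeConnected Prod.fst latticeTgt B ∧
      latticeRank B ≤ j ∧ ∀ i, ∃ e ∈ B, e.1 i = 0 := by
  classical
  rw [rootedEdgeSets, Finset.mem_filter, and_iff_right_iff_imp, Finset.mem_powerset]
  rintro ⟨-, hB, hr, h0⟩ e he
  simp only [Finset.mem_product, Fintype.mem_piFinset, Finset.mem_range, Finset.mem_univ,
    and_true]
  intro i
  exact Nat.lt_succ_of_le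
    ((le_latticeTgt e i).trans ((latticeTgt_le_latticeRank hB (h0 i) he).trans hr))

/-! ### Wrapping the lattice around the torus of side `n + 2`. -/

/-- The covering of the discrete torus by the lattice, with origin `v`. -/
def wrapVertex (v : Fin k → Fin (n + 2)) (x : Fin k → ℕ) : Fin k → Fin (n + 2) :=
  fun i => v i + (x i : Fin (n + 2))

/-- The action of `wrapVertex` on edges. -/
def wrapEdge (v : Fin k → Fin (n + 2)) (e : (Fin k → ℕ) × Fin k) :
    (Fin k → Fin (n + 2)) × Fin k :=
  (wrapVertex v e.1, e.2)

/-- The section of `wrapVertex v` with values in the box `[0, n + 1]^k`. -/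
def unwrapVertex (v : Fin k → Fin (n + 2)) (y : Fin k → Fin (n + 2)) : Fin k → ℕ :=
  fun i => (y i - v i).val

/-- The action of `unwrapVertex` on edges. -/
def unwrapEdge (v : Fin k → Fin (n + 2)) (e : (Fin k → Fin (n + 2)) × Fin k) :
    (Fin k → ℕ) × Fin k :=
  (unwrapVertex v e.1, e.2)

theorem latticeTgt_wrapEdge (v : Fin k → Fin (n + 2)) (e : (Fin k → ℕ) × Fin k) :
    latticeTgt (wrapEdge v e) = wrapVertex v (latticeTgt e) := by
  funext i
  rw [latticeTgt_apply, wrapVertex, latticeTgt_apply]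
  by_cases h : i = e.2
  · rw [if_pos (show i = (wrapEdge v e).2 from h), if_pos h, Nat.cast_add, Nat.cast_one,
      ← add_assoc]
    rfl
  · rw [if_neg (show ¬ i = (wrapEdge v e).2 from h), if_neg h]
    rfl

theorem unwrapVertex_wrapVertex (v : Fin k → Fin (n + 2)) {x : Fin k → ℕ}
    (hx : ∀ i, x i < n + 2) : unwrapVertex v (wrapVertex v x) = x := by
  funext i
  rw [unwrapVertex, wrapVertex, add_sub_cancel_left, Fin.val_natCast, Nat.mod_eq_of_lt (hx i)]

theorem wrapVertex_unwrapVertex (v y : Fin k → Fin (n + 2)) :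
    wrapVertex v (unwrapVertex v y) = y := by
  funext i
  rw [wrapVertex, unwrapVertex, Fin.cast_val_eq_self, add_sub_cancel]

theorem wrapEdge_unwrapEdge (v : Fin k → Fin (n + 2)) (e : (Fin k → Fin (n + 2)) × Fin k) :
    wrapEdge v (unwrapEdge v e) = e := by
  rw [wrapEdge, unwrapEdge, wrapVertex_unwrapVertex]

theorem unwrapEdge_wrapEdge (v : Fin k → Fin (n + 2)) {e : (Fin k → ℕ) × Fin k}
    (he : ∀ i, e.1 i < n + 2) : unwrapEdge v (wrapEdge v e) = e := by
  rw [wrapEdge, unwrapEdge, unwrapVertex_wrapVertex v he]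

/-- The hypothesis says that the edge does not cross the cut between `v - 1` and `v` in its own
direction. -/
theorem latticeTgt_unwrapEdge_lt (v : Fin k → Fin (n + 2)) {e : (Fin k → Fin (n + 2)) × Fin k}
    (he : e.1 e.2 ≠ v e.2 - 1) (i : Fin k) : latticeTgt (unwrapEdge v e) i < n + 2 := by
  rw [latticeTgt_apply]
  have h1 : (unwrapEdge v e).1 i < n + 2 := (e.1 i - v i).isLt
  by_cases h : i = e.2
  · rw [if_pos (show i = (unwrapEdge v e).2 from h)]
    refine lt_of_le_of_ne h1 fun h2 => he ?_
    subst h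
    have h3 : e.1 e.2 - v e.2 + 1 = 0 := by
      have h4 := congrArg (Nat.cast (R := Fin (n + 2))) h2
      rw [Nat.cast_add, Nat.cast_one, Fin.natCast_self] at h4
      rwa [← Fin.cast_val_eq_self (e.1 e.2 - v e.2)]
    rw [eq_sub_iff_add_eq, ← sub_eq_zero, ← h3]
    abel
  · rwa [if_neg (show ¬ i = (unwrapEdge v e).2 from h)]

section WrapTransport

variable (v : Fin k → Fin (n + 2)) {B : Finset ((Fin k → ℕ) × Fin k)}
  (hB : ∀ e ∈ B, ∀ i, latticeTgt e i < n + 2)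

include hB

theorem injOn_wrapEdge : Set.InjOn (wrapEdge v) (B : Set ((Fin k → ℕ) × Fin k)) := by
  intro e he e' he' h
  rw [← unwrapEdge_wrapEdge v fun i => (le_latticeTgt e i).trans_lt (hB e he i), h,
    unwrapEdge_wrapEdge v fun i => (le_latticeTgt e' i).trans_lt (hB e' he' i)]

theorem latticeRank_image_wrapEdge : latticeRank (B.image (wrapEdge v)) = latticeRank B :=
  edgeRank_image (fV := wrapVertex v) (gV := unwrapVertex v) B (fun _ _ => rfl)
    (fun e _ => latticeTgt_wrapEdge v e)
    (fun e he => unwrapVertex_wrapVertex v fun i => (le_latticeTgt e i).trans_lt (hB e he i))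
    (fun e he => unwrapVertex_wrapVertex v (hB e he)) (injOn_wrapEdge v hB)

theorem edgeConnected_image_wrapEdge_iff :
    EdgeConnected Prod.fst latticeTgt (B.image (wrapEdge v))
      ↔ EdgeConnected Prod.fst latticeTgt B :=
  edgeConnected_image_iff (fV := wrapVertex v) (gV := unwrapVertex v) B (fun _ _ => rfl)
    (fun e _ => latticeTgt_wrapEdge v e)
    (fun e he => unwrapVertex_wrapVertex v fun i => (le_latticeTgt e i).trans_lt (hB e he i))
    (fun e he => unwrapVertex_wrapVertex v (hB e he))

theorem moebius_rankLogSeries_image_wrapEdge :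
    Finset.moebius (rankLogSeries latticeRank) (B.image (wrapEdge v))
      = Finset.moebius (rankLogSeries latticeRank) B :=
  moebius_rankLogSeries_image _ B (injOn_wrapEdge v hB) fun _ hA =>
    latticeRank_image_wrapEdge v fun e he => hB e (hA he)

end WrapTransport

theorem latticeTgt_le_of_mem_rootedEdgeSets {j : ℕ} {B : Finset ((Fin k → ℕ) × Fin k)}
    (hB : B ∈ rootedEdgeSets k j) {e : (Fin k → ℕ) × Fin k} (he : e ∈ B) (i : Fin k) :
    latticeTgt e i ≤ j := by
  obtain ⟨-, hc, hr, h0⟩ := mem_rootedEdgeSets.1 hB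
  exact (latticeTgt_le_latticeRank hc (h0 i) he).trans hr

/-- The origin can be recovered from the wrapped edge set. -/
theorem eq_of_image_wrapEdge_eq {j : ℕ} (hj : j ≤ n) {v w : Fin k → Fin (n + 2)}
    {B C : Finset ((Fin k → ℕ) × Fin k)} (hB : B ∈ rootedEdgeSets k j)
    (hC : C ∈ rootedEdgeSets k j) (h : B.image (wrapEdge v) = C.image (wrapEdge w)) : v = w := by
  obtain ⟨-, hBc, -, hB0⟩ := mem_rootedEdgeSets.1 hB
  obtain ⟨-, -, -, hC0⟩ := mem_rootedEdgeSets.1 hC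
  funext i
  by_contra hvw
  have hd : (w i - v i).val ≠ 0 := fun h => hvw (by
    rw [Fin.val_eq_zero_iff, sub_eq_zero] at h
    exact h.symm)
  have hcast : ((w i - v i).val : Fin (n + 2)) = w i - v i := Fin.cast_val_eq_self _
  obtain ⟨c, hc, hc0⟩ := hC0 i
  obtain ⟨e₁, he₁, hec⟩ := Finset.mem_image.1 (h ▸ Finset.mem_image_of_mem (wrapEdge w) hc)
  have h1 : (w i - v i).val ≤ latticeTgt e₁ i := by
    have h2 := congrFun (congrArg Prod.fst hec) i
    simp only [wrapEdge, wrapVertex, hc0, Nat.cast_zero, add_zero] at h2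
    have h3 : (w i - v i).val = e₁.1 i := by
      rw [← h2, add_sub_cancel_left, Fin.val_natCast, Nat.mod_eq_of_lt]
      have := latticeTgt_le_of_mem_rootedEdgeSets hB he₁ i
      have := le_latticeTgt e₁ i
      omega
    exact h3.le.trans (le_latticeTgt _ _)
  -- Seen from `v`, the coordinate `w i` lies at height `(w i - v i).val > 0`. The coordinates of
  -- `B` form an interval from `0`, so the height just below also occurs, at torus coordinate `w i -
  -- 1`. Seen from `w`, only `w i, ..., w i + j` occur, and `j ≤ n` excludes `w i - 1`.
  have key : ∃ e ∈ B, e.1 i = (w i - v i).val - 1 ∨ latticeTgt e i = (w i - v i).val - 1 := by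
    obtain ⟨e₀, he₀, h₀⟩ := hB0 i
    rcases Nat.eq_zero_or_pos ((w i - v i).val - 1) with h2 | h2
    · exact ⟨e₀, he₀, Or.inl (h₀.trans h2.symm)⟩
    · exact exists_coordinate_eq hBc he₀ (by omega) he₁ (by omega)
  obtain ⟨e, he, hev⟩ := key
  obtain ⟨e', he', hee⟩ := Finset.mem_image.1 (h ▸ Finset.mem_image_of_mem (wrapEdge v) he)
  have hcast' : v i + (((w i - v i).val - 1 : ℕ) : Fin (n + 2)) = w i - 1 := by
    rw [Nat.cast_sub (Nat.one_le_iff_ne_zero.2 hd), hcast, Nat.cast_one]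
    abel
  have contra : ∀ x : ℕ, x ≤ j → w i + (x : Fin (n + 2)) ≠ w i - 1 := by
    intro x hx hcon
    have h2 : ((x + 1 : ℕ) : Fin (n + 2)) = 0 := by
      rw [sub_eq_add_neg, add_right_inj, eq_neg_iff_add_eq_zero] at hcon
      rwa [Nat.cast_add, Nat.cast_one]
    have h3 := congrArg Fin.val h2
    rw [Fin.val_natCast, Nat.mod_eq_of_lt (by omega)] at h3
    simp at h3
  have hbound := latticeTgt_le_of_mem_rootedEdgeSets hC he' i
  rcases hev with hev | hev
  · refine contra (e'.1 i) ((le_latticeTgt _ _).trans hbound) ?_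
    have h2 := congrFun (congrArg Prod.fst hee) i
    simp only [wrapEdge, wrapVertex, hev] at h2
    rw [h2, hcast']
  · refine contra (latticeTgt e' i) hbound ?_
    have h2 := congrFun (congrArg latticeTgt hee) i
    rw [latticeTgt_wrapEdge, latticeTgt_wrapEdge] at h2
    simp only [wrapVertex, hev] at h2
    rw [h2, hcast']

/-- A connected edge set of small rank in the discrete torus misses the coordinate before some
coordinate that it attains. -/
theorem exists_corner {B : Finset ((Fin k → Fin (n + 2)) × Fin k)} (hne : B.Nonempty)
    (hB : EdgeConnected Prod.fst latticeTgt B) (hr : latticeRank B ≤ n) (i : Fin k) :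
    ∃ a, (∃ e ∈ B, e.1 i = a) ∧ ∀ e ∈ B, e.1 i ≠ a - 1 := by
  by_cases hP : ∃ a, (∃ e ∈ B, e.1 i = a ∨ latticeTgt e i = a) ∧
      ¬ ∃ e ∈ B, e.1 i = a - 1 ∨ latticeTgt e i = a - 1
  · obtain ⟨a, ⟨e, he, hea⟩, hno⟩ := hP
    push Not at hno
    refine ⟨a, ⟨e, he, ?_⟩, fun e he => (hno e he).1⟩
    rcases hea with hea | hea
    · exact hea
    · rw [latticeTgt_apply] at hea
      split_ifs at hea
      · exact absurd (eq_sub_of_add_eq hea) (hno e he).1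
      · exact hea
  -- Otherwise the attained coordinates are closed under subtracting `1`, so all `n + 2` of them
  -- occur, while the rank allows only `n + 1`.
  · push Not at hP
    exfalso
    obtain ⟨e₀, he₀⟩ := hne
    have hall : ∀ m : ℕ, ∃ e ∈ B, e.1 i = e₀.1 i - (m : Fin (n + 2))
        ∨ latticeTgt e i = e₀.1 i - (m : Fin (n + 2)) := by
      intro m
      induction m with
      | zero => exact ⟨e₀, he₀, Or.inl (by simp)⟩
      | succ m ih =>
        have := hP _ ih
        rwa [sub_sub, ← Nat.cast_succ] at this
    have := card_le_edgeRank_add_one_of_forall hB ⟨e₀, he₀⟩ (fun x => x i) Finset.univ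
      fun a _ => by
        have := hall (e₀.1 i - a).val
        rwa [Fin.cast_val_eq_self, sub_sub_cancel] at this
    rw [Finset.card_univ, Fintype.card_fin] at this
    have : edgeRank Prod.fst latticeTgt B ≤ n := hr
    omega

/-- Take as origin the corner from `exists_corner` in each direction. No edge of `B` crosses the
resulting cuts, so unwrapping preserves rank and connectedness. -/
theorem exists_image_wrapEdge_eq {j : ℕ} (hj : j ≤ n)
    {B : Finset ((Fin k → Fin (n + 2)) × Fin k)} (hne : B.Nonempty)
    (hB : EdgeConnected Prod.fst latticeTgt B) (hr : latticeRank B ≤ j) :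
    ∃ v, ∃ C ∈ rootedEdgeSets k j, C.image (wrapEdge v) = B := by
  choose v hv hv' using exists_corner hne hB (hr.trans hj)
  have hC : (B.image (unwrapEdge v)).image (wrapEdge v) = B := by
    rw [Finset.image_image]
    conv_rhs => rw [← Finset.image_id (s := B)]
    exact Finset.image_congr fun e _ => wrapEdge_unwrapEdge v e
  have hbox : ∀ e ∈ B.image (unwrapEdge v), ∀ i, latticeTgt e i < n + 2 := by
    rw [Finset.forall_mem_image]
    exact fun e he => latticeTgt_unwrapEdge_lt v (hv' e.2 e he)
  refine ⟨v, B.image (unwrapEdge v), mem_rootedEdgeSets.2 ⟨hne.image _, ?_, ?_, fun i => ?_⟩, hC⟩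
  · rwa [← edgeConnected_image_wrapEdge_iff v hbox, hC]
  · rwa [← latticeRank_image_wrapEdge v hbox, hC]
  · obtain ⟨e, he, hei⟩ := hv i
    refine ⟨_, Finset.mem_image_of_mem _ he, ?_⟩
    simp [unwrapEdge, unwrapVertex, hei]

/-! ### Polynomial dependence on the side length. -/

/-- The contribution of one translation class to the logarithmic series of the torus. -/
noncomputable def torusDensity (k j : ℕ) : ℚ :=
  ∑ B ∈ rootedEdgeSets k j,
    PowerSeries.coeff j (Finset.moebius (rankLogSeries latticeRank) B)

/-- Each contributing edge set of the torus comes from exactly one pair of an origin and a rooted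
edge set, and wrapping preserves the Möbius transform. The power counts the origins. -/
theorem coeff_rankLogSeries_torus (k : ℕ) {n j : ℕ} (hj : j ≤ n) :
    PowerSeries.coeff j
      (rankLogSeries latticeRank (Finset.univ : Finset ((Fin k → Fin (n + 2)) × Fin k)))
      = ((n + 2 : ℕ) : ℚ) ^ k * torusDensity k j := by
  classical
  have hne : ∀ e : (Fin k → Fin (n + 2)) × Fin k, e.1 ≠ latticeTgt e := latticeTgt_ne
  have hlt : ∀ B ∈ rootedEdgeSets k j, ∀ e ∈ B, ∀ i, latticeTgt e i < n + 2 :=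
    fun B hB e he i => by
      have := latticeTgt_le_of_mem_rootedEdgeSets hB he i
      omega
  have h1 : ((n + 2 : ℕ) : ℚ) ^ k * torusDensity k j
      = ∑ P ∈ (Finset.univ : Finset (Fin k → Fin (n + 2))) ×ˢ rootedEdgeSets k j,
        PowerSeries.coeff j (Finset.moebius (rankLogSeries latticeRank) P.2) := by
    rw [Finset.sum_product]
    simp [torusDensity]
  rw [h1, ← Finset.sum_moebius (rankLogSeries latticeRank) Finset.univ, map_sum]
  have h2 : ∑ B ∈ (Finset.univ : Finset ((Fin k → Fin (n + 2)) × Fin k)).powerset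
        with B.Nonempty ∧ EdgeConnected Prod.fst latticeTgt B ∧ latticeRank B ≤ j,
        PowerSeries.coeff j (Finset.moebius (rankLogSeries latticeRank) B)
      = ∑ B ∈ (Finset.univ : Finset ((Fin k → Fin (n + 2)) × Fin k)).powerset,
        PowerSeries.coeff j (Finset.moebius (rankLogSeries latticeRank) B) := by
    refine Finset.sum_subset (Finset.filter_subset _ _) fun B hB hB' => ?_
    rw [Finset.mem_filter, not_and, not_and, not_and] at hB'
    rcases B.eq_empty_or_nonempty with rfl | hBne
    · have := Finset.sum_moebius (rankLogSeries latticeRank)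
        (∅ : Finset ((Fin k → Fin (n + 2)) × Fin k))
      rw [Finset.powerset_empty, Finset.sum_singleton,
        rankLogSeries_empty (edgeRank_empty _ _)] at this
      rw [this, map_zero]
    by_cases hc : EdgeConnected Prod.fst latticeTgt B
    · exact PowerSeries.X_pow_dvd_iff.1
        (X_pow_dvd_moebius_rankLogSeries (edgeRank_eq_zero_iff hne)
          (edgeRank_union_le Prod.fst latticeTgt) B) j (not_le.1 (hB' hB hBne hc))
    · have := moebius_rankLogSeries_eq_zero_of_not_edgeConnected hne hc
      rw [this, map_zero]
  rw [← h2]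
  symm
  refine Finset.sum_bij (fun P _ => P.2.image (wrapEdge P.1)) ?_ ?_ ?_ ?_
  · rintro ⟨v, C⟩ hP
    have hC := (Finset.mem_product.1 hP).2
    obtain ⟨hCne, hCc, hCr, -⟩ := mem_rootedEdgeSets.1 hC
    rw [Finset.mem_filter]
    exact ⟨by simp, hCne.image _, (edgeConnected_image_wrapEdge_iff v (hlt C hC)).2 hCc,
      (latticeRank_image_wrapEdge v (hlt C hC)).trans_le hCr⟩
  · rintro ⟨v, C⟩ hP ⟨w, D⟩ hQ h
    have hC := (Finset.mem_product.1 hP).2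
    have hD := (Finset.mem_product.1 hQ).2
    obtain rfl : v = w := eq_of_image_wrapEdge_eq hj hC hD h
    have hu : ∀ D ∈ rootedEdgeSets k j, (D.image (wrapEdge v)).image (unwrapEdge v) = D := by
      intro D hD
      rw [Finset.image_image]
      conv_rhs => rw [← Finset.image_id (s := D)]
      exact Finset.image_congr fun e he => unwrapEdge_wrapEdge v fun i =>
        (le_latticeTgt e i).trans_lt (hlt D hD e he i)
    have h' : C.image (wrapEdge v) = D.image (wrapEdge v) := h
    rw [Prod.mk.injEq]
    refine ⟨rfl, ?_⟩
    rw [← hu C hC, h', hu D hD]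
  · intro B hB
    rw [Finset.mem_filter] at hB
    obtain ⟨v, C, hC, h⟩ := exists_image_wrapEdge_eq hj hB.2.1 hB.2.2.1 hB.2.2.2
    exact ⟨(v, C), Finset.mem_product.2 ⟨Finset.mem_univ _, hC⟩, h⟩
  · rintro ⟨v, C⟩ hP
    rw [moebius_rankLogSeries_image_wrapEdge v (hlt C (Finset.mem_product.1 hP).2)]

/-- The coefficients of low order in the rank generating series of the discrete torus are
polynomials in its side length. -/
theorem exists_polynomial_coeff_rankSeries_torus (k r : ℕ) :
    ∃ φ : ℚ[X], ∀ n, r ≤ n → PowerSeries.coeff r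
      (rankSeries latticeRank (Finset.univ : Finset ((Fin k → Fin (n + 2)) × Fin k)))
      = φ.eval ((n + 2 : ℕ) : ℚ) := by
  induction r using Nat.strong_induction_on with
  | _ r ih =>
    rcases Nat.eq_zero_or_pos r with rfl | hr
    · refine ⟨1, fun n _ => ?_⟩
      rw [PowerSeries.coeff_zero_eq_constantCoeff_apply,
        constantCoeff_rankSeries (edgeRank_eq_zero_iff latticeTgt_ne), eval_one]
    · choose! φ hφ using ih
      -- This is `Z L = X Z'` in degree `r`, solved for the coefficient of `Z`. The term `p.1 = r`
      -- drops out because `L` has no constant term.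
      refine ⟨C (r : ℚ)⁻¹ * ∑ p ∈ Finset.HasAntidiagonal.antidiagonal r with p.1 < r,
        φ p.1 * (X ^ k * C (torusDensity k p.2)), fun n hn => ?_⟩
      set Z := rankSeries latticeRank (Finset.univ : Finset ((Fin k → Fin (n + 2)) × Fin k))
        with hZ
      have h := congrArg (PowerSeries.coeff r) (rankSeries_mul_rankLogSeries
        (edgeRank_eq_zero_iff (latticeTgt_ne (R := Fin (n + 2))))
        (Finset.univ : Finset ((Fin k → Fin (n + 2)) × Fin k)))
      rw [← hZ] at h
      have hleft : PowerSeries.coeff r (PowerSeries.X * PowerSeries.derivative ℚ Z)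
          = r * PowerSeries.coeff r Z := by
        obtain ⟨m, rfl⟩ := Nat.exists_eq_succ_of_ne_zero hr.ne'
        rw [PowerSeries.coeff_succ_X_mul, PowerSeries.coeff_derivative]
        push_cast
        ring
      rw [hleft, PowerSeries.coeff_mul, ← Finset.sum_filter_add_sum_filter_not _ fun p => p.1 < r]
        at h
      have hzero : ∑ p ∈ Finset.HasAntidiagonal.antidiagonal r with ¬ p.1 < r,
          PowerSeries.coeff p.1 Z *
          PowerSeries.coeff p.2 (rankLogSeries latticeRank
            (Finset.univ : Finset ((Fin k → Fin (n + 2)) × Fin k))) = 0 := by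
        refine Finset.sum_eq_zero fun p hp => ?_
        rw [Finset.mem_filter, Finset.HasAntidiagonal.mem_antidiagonal] at hp
        have : p.2 = 0 := by omega
        rw [this, rankLogSeries, mul_assoc, PowerSeries.coeff_zero_X_mul, mul_zero]
      rw [hzero, add_zero] at h
      have hr' : (r : ℚ) ≠ 0 := Nat.cast_ne_zero.2 hr.ne'
      rw [eval_mul, eval_C, eq_inv_mul_iff_mul_eq₀ hr', ← h, eval_finsetSum]
      refine Finset.sum_congr rfl fun p hp => ?_
      rw [Finset.mem_filter, Finset.HasAntidiagonal.mem_antidiagonal] at hp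
      rw [hφ p.1 hp.2 n (by omega), coeff_rankLogSeries_torus k (by omega), eval_mul, eval_mul,
        eval_pow, eval_X, eval_C]

/-! ### Powers of cycles as edge families, and the conclusion. -/

/-- For `n = 0` every edge is listed twice, since `1 = -1` in `Fin 2`; a family, unlike a set of
edges, permits this. -/
theorem isEdgeFamily_cartesianPower_cycleGraph (k n : ℕ) :
    ((SimpleGraph.cycleGraph (n + 2)).cartesianPower k).IsEdgeFamily
      (Prod.fst : (Fin k → Fin (n + 2)) × Fin k → _) latticeTgt := by
  have hadj : ∀ a b : Fin (n + 2), (SimpleGraph.cycleGraph (n + 2)).Adj a b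
      ↔ b = a + 1 ∨ a = b + 1 := fun a b => by
    rw [SimpleGraph.cycleGraph_adj, sub_eq_iff_eq_add, sub_eq_iff_eq_add, or_comm,
      add_comm 1, add_comm 1]
  have htgt : ∀ (x y : Fin k → Fin (n + 2)) (i : Fin k),
      latticeTgt (x, i) = y ↔ y i = x i + 1 ∧ ∀ j, j ≠ i → x j = y j := fun x y i => by
    rw [funext_iff]
    constructor
    · intro h
      refine ⟨?_, fun j hj => ?_⟩
      · rw [← h i, latticeTgt_apply, if_pos rfl]
      · rw [← h j, latticeTgt_apply, if_neg hj]
    · rintro ⟨h1, h2⟩ j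
      rw [latticeTgt_apply]
      split_ifs with hj
      · rw [hj]; exact h1.symm
      · exact h2 j hj
  intro x y
  constructor
  · rintro ⟨i, h, h'⟩
    rcases (hadj _ _).1 h with h | h
    · exact ⟨(x, i), Or.inl ⟨rfl, (htgt _ _ _).2 ⟨h, h'⟩⟩⟩
    · exact ⟨(y, i), Or.inr ⟨rfl, (htgt _ _ _).2 ⟨h, fun j hj => (h' j hj).symm⟩⟩⟩
  · rintro ⟨⟨z, i⟩, ⟨rfl, h⟩ | ⟨rfl, h⟩⟩
    · obtain ⟨h1, h2⟩ := (htgt _ _ _).1 h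
      exact ⟨i, (hadj _ _).2 (Or.inl h1), h2⟩
    · obtain ⟨h1, h2⟩ := (htgt _ _ _).1 h
      exact ⟨i, (hadj _ _).2 (Or.inr h1), fun j hj => (h2 j hj).symm⟩

end Lattice

theorem isEdgeFamily_cartesianPower_of_subsingleton {V : Type*} [Subsingleton V]
    (G : SimpleGraph V) (k : ℕ) :
    (G.cartesianPower k).IsEdgeFamily (PEmpty.elim : PEmpty.{1} → _) PEmpty.elim := fun _ _ =>
  ⟨fun ⟨_, h, _⟩ => absurd (Subsingleton.elim _ _) h.ne, fun ⟨e, _⟩ => e.elim⟩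

theorem chromaticPolynomial_cartesianPower_cycleGraph (q k : ℕ) :
    ((SimpleGraph.cycleGraph q).cartesianPower k).chromaticPolynomial ≠ 0 ∧
      ((SimpleGraph.cycleGraph q).cartesianPower k).chromaticPolynomial.natDegree = q ^ k := by
  have hcard : Nat.card (Fin k → Fin q) = q ^ k := by simp
  rw [← hcard]
  match q with
  | 0 =>
    have h := isEdgeFamily_cartesianPower_of_subsingleton (SimpleGraph.cycleGraph 0) k
    exact ⟨h.chromaticPolynomial_ne_zero, h.natDegree_chromaticPolynomial⟩
  | 1 =>
    have h := isEdgeFamily_cartesianPower_of_subsingleton (SimpleGraph.cycleGraph 1) k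
    exact ⟨h.chromaticPolynomial_ne_zero, h.natDegree_chromaticPolynomial⟩
  | n + 2 =>
    have h := isEdgeFamily_cartesianPower_cycleGraph k n
    exact ⟨h.chromaticPolynomial_ne_zero, h.natDegree_chromaticPolynomial⟩

theorem mainTheorem8 (k : ℕ) :
    IsTwoLevelPolynomial
      (X ^ k)
      (fun q : ℕ => ((max ((q : ℤ) - 2) (-1) : ℤ) : WithTop ℤ))
      (fun q : ℕ => ((SimpleGraph.cycleGraph q).cartesianPower k).chromaticPolynomial) := by
  have hnonneg : ∀ q : ℕ, (0 : ℚ) ≤ (X ^ k : ℚ[X]).eval (q : ℚ) := fun q => by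
    rw [eval_pow, eval_X]
    positivity
  refine ⟨fun z => ⟨z ^ k, by simp⟩, Filter.Eventually.of_forall hnonneg,
    fun q => WithTop.coe_le_coe.2 (le_max_right _ _),
    fun q hq => absurd (hnonneg q) (not_le.2 hq), fun q _ => ?_, ?_⟩
  · obtain ⟨h1, h2⟩ := chromaticPolynomial_cartesianPower_cycleGraph q k
    refine ⟨h1, ?_⟩
    rw [h2, eval_pow, eval_X, Nat.cast_pow]
  · choose φ hφ using exists_polynomial_coeff_rankSeries_torus k
    refine ⟨φ, fun q _ r hr => ?_⟩
    rw [WithTop.coe_le_coe] at hr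
    -- As `r ≥ 0`, the bound `r ≤ max (q - 2) (-1)` forces `q ≥ 2`, and then it reads `r ≤ n`.
    obtain ⟨n, rfl⟩ : ∃ n, q = n + 2 := ⟨q - 2, by omega⟩
    rw [(isEdgeFamily_cartesianPower_cycleGraph k n).codegreeCoeff_chromaticPolynomial,
      ← hφ r n (by push_cast at hr; omega)]
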